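/- For $\alpha>0$, $\beta>0$, $\sigma>1$ let $$\mathcal K_{\alpha,\beta,\sigma}(t,s)=\alpha+2\beta\sum_{k=1}^\infty k^{-\sigma}\cos(2\pi k(t-s)),\qquad t,s\in[0,1],$$ be the Korobov kernel. Let $(\alpha_j)$, $(\beta_j)$, $(\sigma_j)$, $j\in\mathbb N=\{1,2,\dots\}$, be real sequences with $\alpha_j>0$, $\beta_j>0$, $\sigma_j>1$ for all $j$, such that, as $j\to\infty$, $$\beta_j\sim c\,j^{-1},\qquad \alpha_j/\beta_j\to r,\qquad \sigma_j\to\infty,$$ where $c>0$ and $0\le r<\infty$. Write $\mathcal K_j=\mathcal K_{\alpha_j,\beta_j,\sigma_j}$. For each $d\in\mathbb N$ let $Y_d(t)$, $t\in[0,1]^d$, be a real, zero-mean, jointly measurable random field on some probability space, with finite second moments and covariance function $$\mathbb E\,Y_d(t)Y_d(s)=\sum_{j=1}^d\mathcal K_j(t_j,s_j),\qquad t,s\in[0,1]^d,$$ considered as a random element of $L_2([0,1]^d)$ with scalar product $(\cdot,\cdot)_{2,d}$ and norm $\|\cdot\|_{2,d}$. For $n\ge 0$ and $\varepsilon\in(0,1)$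 put $$e^{Y_d}(n)=\inf_{\psi_1,\dots,\psi_n\in L_2([0,1]^d)}\Bigl(\mathbb E\Bigl\|Y_d-\sum_{m=1}^n (Y_d,\psi_m)_{2,d}\,\psi_m\Bigr\|_{2,d}^2\Bigr)^{1/2},\qquad n^{Y_d}(\varepsilon)=\min\{n\in\mathbb N:\ e^{Y_d}(n)\le\varepsilon\, e^{Y_d}(0)\},$$ so that $e^{Y_d}(0)=(\mathbb E\|Y_d\|_{2,d}^2)^{1/2}$. Theorem (Korobov kernels, $\tau=1$). Let $\varepsilon_0=(1+r/2)^{-1/2}$. Then $\varepsilon_0\in(0,1]$ and $$1-\varepsilon_0^2=\lim_{d\to\infty}\frac{\sum_{j=1}^d \tilde\lambda_{0,j}}{\sum_{j=1}^d\Lambda_j},$$ where $\tilde\lambda_{0,j}=\int_0^1\!\int_0^1\mathcal K_j(t,s)\,ds\,dt$ is the eigenvalue of the integral operator on $L_2([0,1])$ with kernel $\mathcal K_j$ that belongs to the constant function $1$, and $\Lambda_j=\int_0^1\mathcal K_j(t,t)\,dt$ is the trace of this operator. For every $\varepsilon\in(0,\varepsilon_0)$ the number $1-(\varepsilon/\varepsilon_0)^2$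 lies in $(0,1)$, and $$\ln n^{Y_d}(\varepsilon)=\bigl(1-(\varepsilon/\varepsilon_0)^2\bigr)\ln d+o(\ln d),\qquad d\to\infty.$$ -/

import Mathlib

open MeasureTheory ProbabilityTheory Filter Topology Asymptotics
open scoped ENNReal

noncomputable section

/-- The Korobov kernel
`𝒦_{α,β,σ}(t,s) = α + 2 β ∑_{k ≥ 1} k ^ (-σ) cos (2 π k (t - s))` on `[0,1]²`. -/
def korobovKernel (α β σ : ℝ) (t s : unitInterval) : ℝ :=
  α + 2 * β * ∑' k : ℕ, ((k : ℝ) + 1) ^ (-σ) *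
    Real.cos (2 * Real.pi * ((k : ℝ) + 1) * ((t : ℝ) - (s : ℝ)))

/-- The additive covariance function `(t, s) ↦ ∑_{j=1}^d K_j(t_j, s_j)` on `[0,1]^d`.
The coordinates of a point of `[0,1]^d` are numbered by `Fin d = {0, …, d - 1}`, so that
coordinate `j : Fin d` is the `(j + 1)`-st one and carries the kernel `K (j + 1)`. -/
def additiveKernel (K : ℕ → unitInterval → unitInterval → ℝ) (d : ℕ) (t s : Fin d → unitInterval) : ℝ :=
  ∑ j : Fin d, K ((j : ℕ) + 1) (t j) (s j)

/-- `Y` is a zero-mean (real) random field on `[0,1]^d` with finite second moments and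
covariance function `K`, jointly measurable in `(ω, t)` up to null sets, so that it is a random
element of `L₂([0,1]^d)` whenever `∫ K(t,t) dt < ∞`. -/
structure IsCenteredField {Ω : Type*} [MeasurableSpace Ω] (P : Measure Ω) {d : ℕ}
    (Y : Ω → (Fin d → unitInterval) → ℝ) (K : (Fin d → unitInterval) → (Fin d → unitInterval) → ℝ) : Prop where
  aemeasurable : AEMeasurable (Function.uncurry Y) (P.prod (volume : Measure (Fin d → unitInterval)))
  memLp : ∀ t, MemLp (fun ω => Y ω t) 2 P
  mean_eq_zero : ∀ t, ∫ ω, Y ω t ∂P = 0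
  cov_eq : ∀ t s, cov[fun ω => Y ω t, fun ω => Y ω s; P] = K t s

/-- The path `t ↦ ∑_{m=1}^n (y, ψ_m)_{2,d} ψ_m(t)` of the linear approximation of rank `n`
built from `ψ_1, …, ψ_n ∈ L₂([0,1]^d)`, for a path `y`. -/
def linearApprox {d n : ℕ} (ψ : Fin n → Lp ℝ 2 (volume : Measure (Fin d → unitInterval)))
    (y : (Fin d → unitInterval) → ℝ) (t : Fin d → unitInterval) : ℝ :=
  ∑ m : Fin n, (∫ s, y s * ψ m s) * ψ m t

/-- The smallest 2-average error
`e^Y(n) = inf_ψ (𝔼 ‖Y - ∑_{m=1}^n (Y, ψ_m) ψ_m‖²)^{1/2}`; for `n = 0` the only approximation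
is the zero element, so that `e^Y(0) = (𝔼 ‖Y‖²)^{1/2}`. -/
def avgError {Ω : Type*} [MeasurableSpace Ω] (P : Measure Ω) {d : ℕ}
    (Y : Ω → (Fin d → unitInterval) → ℝ) (n : ℕ) : ℝ≥0∞ :=
  ⨅ ψ : Fin n → Lp ℝ 2 (volume : Measure (Fin d → unitInterval)),
    (∫⁻ ω, (eLpNorm (fun t => Y ω t - linearApprox ψ (Y ω) t) 2 volume) ^ 2 ∂P) ^ (1 / 2 : ℝ)

/-- The average case approximation complexity
`n^Y(ε) = min {n ≥ 1 : e^Y(n) ≤ ε e^Y(0)}`. -/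
def approxComplexity {Ω : Type*} [MeasurableSpace Ω] (P : Measure Ω) {d : ℕ}
    (Y : Ω → (Fin d → unitInterval) → ℝ) (ε : ℝ) : ℕ :=
  sInf {n : ℕ | 1 ≤ n ∧ avgError P Y n ≤ ENNReal.ofReal ε * avgError P Y 0}

/-- If the function identically `1` is an eigenvector of the integral operator on `L₂[0,1]`
with kernel `K`, then `∬ K(t,s) ds dt = (1, K 1)` is its eigenvalue (as `‖1‖ = 1`). -/
def oneEigenvalue (K : unitInterval → unitInterval → ℝ) : ℝ := ∫ t, ∫ s, K t s

/-- The trace of the integral operator on `L₂[0,1]` with a continuous covariance kernel `K`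
(the sum of its eigenvalues), i.e. the mean squared `L₂`-norm of the process. -/
def kernelTrace (K : unitInterval → unitInterval → ℝ) : ℝ := ∫ t, K t t

end

/-! ### Finite-rank approximation in a Hilbert space -/

section Hilbert

open scoped InnerProductSpace

variable {H : Type*} [NormedAddCommGroup H] [InnerProductSpace ℝ H]

/-- The approxResidual `y - ∑ ⟪ψ m, y⟫ ψ m` of a linear approximation of finite rank. -/
def approxResidual {n : ℕ} (ψ : Fin n → H) (y : H) : H := y - ∑ m, ⟪ψ m, y⟫_ℝ • ψ m

lemma inner_approxResidual_comm {n : ℕ} (ψ : Fin n → H) (x y : H) :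
    ⟪approxResidual ψ x, y⟫_ℝ = ⟪x, approxResidual ψ y⟫_ℝ := by
  simp only [approxResidual, inner_sub_left, inner_sub_right, sum_inner, inner_sum,
    real_inner_smul_left, real_inner_smul_right]
  congr 1
  refine Finset.sum_congr rfl fun m _ => ?_
  rw [real_inner_comm x (ψ m)]
  ring

lemma norm_sq_approxResidual_of_orthonormal {n : ℕ} {ψ : Fin n → H} (hψ : Orthonormal ℝ ψ) (y : H) :
    ‖approxResidual ψ y‖ ^ 2 = ‖y‖ ^ 2 - ∑ m, ⟪ψ m, y⟫_ℝ ^ 2 := by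
  have h1 : ⟪∑ m, ⟪ψ m, y⟫_ℝ • ψ m, ∑ m, ⟪ψ m, y⟫_ℝ • ψ m⟫_ℝ = ∑ m, ⟪ψ m, y⟫_ℝ ^ 2 := by
    rw [hψ.inner_sum]
    simp [sq]
  have h2 : ⟪y, ∑ m, ⟪ψ m, y⟫_ℝ • ψ m⟫_ℝ = ∑ m, ⟪ψ m, y⟫_ℝ ^ 2 := by
    simp only [inner_sum, real_inner_smul_right, real_inner_comm, sq]
  rw [approxResidual, norm_sub_sq_real, ← real_inner_self_eq_norm_sq (∑ m, ⟪ψ m, y⟫_ℝ • ψ m), h1, h2]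
  ring

/-- The residuals of an orthonormal family under an approximation of rank `n` have weighted total
size at least `∑ lam i - M n`. -/
lemma sum_mul_norm_sq_approxResidual_ge {ι : Type*} {φ : ι → H} (hφ : Orthonormal ℝ φ)
    {n : ℕ} (ψ : Fin n → H) (F : Finset ι) {lam : ι → ℝ} {M : ℝ} (h0 : ∀ i ∈ F, 0 ≤ lam i)
    (hM : ∀ i ∈ F, lam i ≤ M) (hM0 : 0 ≤ M) :
    ∑ i ∈ F, lam i - M * n ≤ ∑ i ∈ F, lam i * ‖approxResidual ψ (φ i)‖ ^ 2 := by
  set V := Submodule.span ℝ (Set.range ψ) with hV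
  have : FiniteDimensional ℝ V := FiniteDimensional.span_of_finite ℝ (Set.finite_range ψ)
  have hproj (x : H) : ‖x‖ ^ 2 - ‖V.starProjection x‖ ^ 2 ≤ ‖approxResidual ψ x‖ ^ 2 := by
    have h1 : ‖x - V.starProjection x‖ ≤ ‖approxResidual ψ x‖ := by
      rw [Submodule.starProjection_minimal]
      have hmem : ∑ m, ⟪ψ m, x⟫_ℝ • ψ m ∈ V :=
        Submodule.sum_mem _ fun m _ => Submodule.smul_mem _ _ (Submodule.subset_span ⟨m, rfl⟩)
      exact ciInf_le ⟨0, by rintro _ ⟨w, rfl⟩; positivity⟩ (⟨_, hmem⟩ : V)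
    have h2 : ‖x‖ ^ 2 = ‖V.starProjection x‖ ^ 2 + ‖x - V.starProjection x‖ ^ 2 := by
      have := Submodule.norm_sq_eq_add_norm_sq_starProjection x V
      rwa [Submodule.starProjection_orthogonal_val] at this
    have := pow_le_pow_left₀ (norm_nonneg _) h1 2
    linarith
  have hbessel : ∑ i ∈ F, ‖V.starProjection (φ i)‖ ^ 2 ≤ n := by
    set u := stdOrthonormalBasis ℝ V
    have h1 (x : H) : ‖V.starProjection x‖ ^ 2 = ∑ m, ⟪(u m : H), x⟫_ℝ ^ 2 := by
      rw [Submodule.starProjection_apply, ← Submodule.coe_norm,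
        ← u.sum_sq_norm_inner_right]
      refine Finset.sum_congr rfl fun m _ => ?_
      rw [Real.norm_eq_abs, sq_abs, Submodule.coe_inner]
      congr 1
      rw [← Submodule.starProjection_apply, ← Submodule.inner_starProjection_left_eq_right,
        Submodule.starProjection_eq_self_iff.2 (u m).2]
    calc ∑ i ∈ F, ‖V.starProjection (φ i)‖ ^ 2
        = ∑ m, ∑ i ∈ F, ⟪φ i, (u m : H)⟫_ℝ ^ 2 := by
          simp only [h1, real_inner_comm]
          exact Finset.sum_comm
      _ ≤ ∑ m, ‖(u m : H)‖ ^ 2 := Finset.sum_le_sum fun m _ => by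
          simpa using hφ.sum_inner_products_le (u m : H) (s := F)
      _ = Module.finrank ℝ V := by
          have h2 (m) : ‖(u m : H)‖ = 1 := u.orthonormal.1 m
          simp [h2]
      _ ≤ n := by
          have := finrank_range_le_card (R := ℝ) ψ
          rw [Fintype.card_fin] at this
          exact_mod_cast this
  have h3 : ∑ i ∈ F, lam i * (1 - ‖V.starProjection (φ i)‖ ^ 2)
      ≤ ∑ i ∈ F, lam i * ‖approxResidual ψ (φ i)‖ ^ 2 :=
    Finset.sum_le_sum fun i hi => mul_le_mul_of_nonneg_left (by
      have := hproj (φ i)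
      rwa [hφ.1 i, one_pow] at this) (h0 i hi)
  have h4 : ∑ i ∈ F, lam i * ‖V.starProjection (φ i)‖ ^ 2 ≤ M * n :=
    calc _ ≤ ∑ i ∈ F, M * ‖V.starProjection (φ i)‖ ^ 2 :=
          Finset.sum_le_sum fun i hi => mul_le_mul_of_nonneg_right (hM i hi) (by positivity)
      _ ≤ M * n := by
          rw [← Finset.mul_sum]
          exact mul_le_mul_of_nonneg_left hbessel hM0
  simp only [mul_sub, mul_one, Finset.sum_sub_distrib] at h3
  linarith

/-- Given vectors `v i`, some finite orthonormal family satisfies Parseval's identity for all of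
them. -/
lemma exists_orthonormal_parseval {ι : Type*} [Finite ι] (v : ι → H) :
    ∃ (N : ℕ) (b : Fin N → H), Orthonormal ℝ b ∧ ∀ i, ∑ k, ⟪b k, v i⟫_ℝ ^ 2 = ‖v i‖ ^ 2 := by
  set V := Submodule.span ℝ (Set.range v) with hV
  have : FiniteDimensional ℝ V := FiniteDimensional.span_of_finite ℝ (Set.finite_range v)
  set u := stdOrthonormalBasis ℝ V
  refine ⟨_, fun k => (u k : H), u.orthonormal.comp_linearIsometry V.subtypeₗᵢ, fun i => ?_⟩
  have := u.sum_sq_norm_inner_right ⟨v i, Submodule.subset_span ⟨i, rfl⟩⟩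
  simpa using this

end Hilbert

/-! ### Second-order random fields -/

section Field

variable {Ω X : Type*} [MeasurableSpace Ω] [MeasurableSpace X] {P : Measure Ω}
  [IsProbabilityMeasure P] {μ : Measure X} [IsProbabilityMeasure μ] {Y : Ω → X → ℝ}
  {K : X → X → ℝ} {T : ℝ}

lemma eLpNorm_two_sq {α : Type*} [MeasurableSpace α] (ν : Measure α) (f : α → ℝ) :
    eLpNorm f 2 ν ^ 2 = ∫⁻ x, ‖f x‖ₑ ^ 2 ∂ν := by
  have := eLpNorm_nnreal_pow_eq_lintegral (f := f) (μ := ν) (p := 2) two_ne_zero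
  simpa using this

lemma lintegral_enorm_sq_eq_ofReal {α : Type*} [MeasurableSpace α] {ν : Measure α} {f : α → ℝ}
    (hf : MemLp f 2 ν) : ∫⁻ x, ‖f x‖ₑ ^ 2 ∂ν = ENNReal.ofReal (∫ x, f x * f x ∂ν) := by
  rw [ofReal_integral_eq_lintegral_ofReal (f := fun x => f x * f x) (hf.integrable_mul hf)
    (Eventually.of_forall fun x => mul_self_nonneg _)]
  refine lintegral_congr fun x => ?_
  rw [← sq, Real.enorm_eq_ofReal_abs, ← ENNReal.ofReal_pow (abs_nonneg _), sq_abs]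

lemma lintegral_lintegral_enorm_sq (hm : AEMeasurable (Function.uncurry Y) (P.prod μ))
    (hL : ∀ t, MemLp (fun ω => Y ω t) 2 P) (hT : ∀ t, ∫ ω, Y ω t * Y ω t ∂P = T) :
    ∫⁻ ω, ∫⁻ t, ‖Y ω t‖ₑ ^ 2 ∂μ ∂P = ENNReal.ofReal T := by
  rw [lintegral_lintegral_swap (hm.enorm.pow_const 2)]
  simp [lintegral_enorm_sq_eq_ofReal (hL _), hT]

lemma ae_memLp_path (hm : AEMeasurable (Function.uncurry Y) (P.prod μ))
    (hL : ∀ t, MemLp (fun ω => Y ω t) 2 P) (hT : ∀ t, ∫ ω, Y ω t * Y ω t ∂P = T) :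
    ∀ᵐ ω ∂P, MemLp (Y ω) 2 μ := by
  have h1 : ∀ᵐ ω ∂P, ∫⁻ t, ‖Y ω t‖ₑ ^ 2 ∂μ < ∞ := by
    refine ae_lt_top' ?_ ?_
    · exact AEMeasurable.lintegral_prod_right' (f := fun z : Ω × X => ‖Function.uncurry Y z‖ₑ ^ 2)
        (hm.enorm.pow_const 2)
    · rw [lintegral_lintegral_enorm_sq hm hL hT]
      exact ENNReal.ofReal_ne_top
  filter_upwards [h1, hm.aestronglyMeasurable.prodMk_left] with ω h1 h2
  refine ⟨h2, ?_⟩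
  rw [← eLpNorm_two_sq] at h1
  exact (ENNReal.pow_lt_top_iff.1 h1).resolve_right two_ne_zero

lemma integrable_triple (hm : AEMeasurable (Function.uncurry Y) (P.prod μ))
    (hL : ∀ t, MemLp (fun ω => Y ω t) 2 P) (hT : ∀ t, ∫ ω, Y ω t * Y ω t ∂P = T)
    {g : X → ℝ} (hg : Integrable g μ) :
    Integrable (fun z : Ω × X × X => Y z.1 z.2.1 * g z.2.1 * (Y z.1 z.2.2 * g z.2.2))
      (P.prod (μ.prod μ)) := by
  have hq1 : Measure.QuasiMeasurePreserving (fun z : Ω × X × X => (z.1, z.2.1))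
      (P.prod (μ.prod μ)) (P.prod μ) :=
    ((MeasurePreserving.id P).prod (measurePreserving_fst (μ := μ) (ν := μ))).quasiMeasurePreserving
  have hq2 : Measure.QuasiMeasurePreserving (fun z : Ω × X × X => (z.1, z.2.2))
      (P.prod (μ.prod μ)) (P.prod μ) :=
    ((MeasurePreserving.id P).prod (measurePreserving_snd (μ := μ) (ν := μ))).quasiMeasurePreserving
  have hYg : AEMeasurable (fun z : Ω × X => Y z.1 z.2 * g z.2) (P.prod μ) :=
    hm.mul (hg.aemeasurable.comp_quasiMeasurePreserving Measure.quasiMeasurePreserving_snd)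
  have hF : AEStronglyMeasurable
      (fun z : Ω × X × X => Y z.1 z.2.1 * g z.2.1 * (Y z.1 z.2.2 * g z.2.2))
      (P.prod (μ.prod μ)) :=
    ((hYg.comp_quasiMeasurePreserving hq1).mul
      (hYg.comp_quasiMeasurePreserving hq2)).aestronglyMeasurable
  rw [integrable_prod_iff' hF]
  have hint (t s : X) : Integrable (fun ω => Y ω t * Y ω s) P := (hL t).integrable_mul (hL s)
  have hbd (t s : X) : ∫ ω, |Y ω t * Y ω s| ∂P ≤ T := by
    have h1 : ∫ ω, |Y ω t * Y ω s| ∂P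
        ≤ ∫ ω, (1 / 2 * (Y ω t * Y ω t) + 1 / 2 * (Y ω s * Y ω s)) ∂P := by
      refine integral_mono (hint t s).abs (((hint t t).const_mul _).add ((hint s s).const_mul _))
        fun ω => ?_
      simp only [abs_mul]
      nlinarith [sq_nonneg (|Y ω t| - |Y ω s|), abs_mul_abs_self (Y ω t), abs_mul_abs_self (Y ω s)]
    rw [integral_add ((hint t t).const_mul _) ((hint s s).const_mul _), integral_const_mul,
      integral_const_mul, hT, hT] at h1
    linarith
  refine ⟨Eventually.of_forall fun z => ?_, ?_⟩
  · refine ((hint z.1 z.2).mul_const (g z.1 * g z.2)).congr (Eventually.of_forall fun ω => ?_)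
    simp only
    ring
  · refine Integrable.mono' ((hg.abs.mul_prod hg.abs).const_mul T)
      hF.norm.prod_swap.integral_prod_right' (Eventually.of_forall fun z => ?_)
    have h2 : ∫ ω, ‖Y ω z.1 * g z.1 * (Y ω z.2 * g z.2)‖ ∂P
        = (∫ ω, |Y ω z.1 * Y ω z.2| ∂P) * (|g z.1| * |g z.2|) := by
      rw [← integral_mul_const]
      refine integral_congr_ae (Eventually.of_forall fun ω => ?_)
      simp only [Real.norm_eq_abs, abs_mul]
      ring
    rw [Real.norm_of_nonneg (integral_nonneg fun ω => norm_nonneg _), h2]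
    exact mul_le_mul_of_nonneg_right (hbd _ _) (by positivity)

/-- `𝔼 (Y, g)² = ∬ K(t, s) g(t) g(s) dt ds`. -/
lemma lintegral_sq_integral_mul (hm : AEMeasurable (Function.uncurry Y) (P.prod μ))
    (hL : ∀ t, MemLp (fun ω => Y ω t) 2 P) (hT : ∀ t, ∫ ω, Y ω t * Y ω t ∂P = T)
    (hK : ∀ t s, ∫ ω, Y ω t * Y ω s ∂P = K t s) {g : X → ℝ} (hg : Integrable g μ) :
    AEMeasurable (fun ω => ENNReal.ofReal ((∫ t, Y ω t * g t ∂μ) ^ 2)) P ∧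
    ∫⁻ ω, ENNReal.ofReal ((∫ t, Y ω t * g t ∂μ) ^ 2) ∂P
      = ENNReal.ofReal (∫ z, K z.1 z.2 * (g z.1 * g z.2) ∂(μ.prod μ)) := by
  have hI := integrable_triple hm hL hT hg
  have h1 (ω : Ω) : ∫ z : X × X, Y ω z.1 * g z.1 * (Y ω z.2 * g z.2) ∂(μ.prod μ)
      = (∫ t, Y ω t * g t ∂μ) ^ 2 := by
    rw [integral_prod_mul (fun t => Y ω t * g t) (fun t => Y ω t * g t), sq]
  have hI2 : Integrable (fun ω => (∫ t, Y ω t * g t ∂μ) ^ 2) P := by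
    simpa only [h1] using hI.integral_prod_left
  refine ⟨hI2.aemeasurable.ennreal_ofReal, ?_⟩
  rw [← ofReal_integral_eq_lintegral_ofReal hI2 (Eventually.of_forall fun ω => sq_nonneg _)]
  congr 1
  simp only [← h1]
  rw [integral_integral_swap (f := fun (ω : Ω) (z : X × X) =>
    Y ω z.1 * g z.1 * (Y ω z.2 * g z.2)) hI]
  refine integral_congr_ae (Eventually.of_forall fun z => ?_)
  simp only
  rw [← hK, ← integral_mul_const]
  refine integral_congr_ae (Eventually.of_forall fun ω => ?_)
  simp only
  ring

end Field

/-! ### Average errors of a centered field with constant variance -/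

section AvgError

open scoped InnerProductSpace

variable {Ω : Type*} [MeasurableSpace Ω] {P : Measure Ω} {d : ℕ}
  {Y : Ω → (Fin d → unitInterval) → ℝ} {K : (Fin d → unitInterval) → (Fin d → unitInterval) → ℝ}
  {T : ℝ}

/-- The Hilbert space `L₂([0,1]^d)`. -/
noncomputable abbrev L2Cube (d : ℕ) := Lp ℝ 2 (volume : Measure (Fin d → unitInterval))

lemma inner_toLp_eq_integral {y : (Fin d → unitInterval) → ℝ} (hy : MemLp y 2 volume)
    (g : L2Cube d) : ⟪g, hy.toLp y⟫_ℝ = ∫ t, y t * g t := by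
  rw [L2.inner_def]
  refine integral_congr_ae ?_
  filter_upwards [hy.coeFn_toLp] with t ht
  rw [ht]
  simp

lemma eLpNorm_sub_linearApprox {n : ℕ} (ψ : Fin n → L2Cube d)
    {y : (Fin d → unitInterval) → ℝ} (hy : MemLp y 2 volume) :
    eLpNorm (fun t => y t - linearApprox ψ y t) 2 volume ^ 2
      = ENNReal.ofReal (‖approxResidual ψ (hy.toLp y)‖ ^ 2) := by
  rw [ENNReal.ofReal_pow (norm_nonneg _), ofReal_norm, Lp.enorm_def]
  congr 1
  refine eLpNorm_congr_ae ?_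
  rw [approxResidual]
  have hsum : ((∑ m, ⟪ψ m, hy.toLp y⟫_ℝ • ψ m : L2Cube d) : (Fin d → unitInterval) → ℝ)
      =ᵐ[volume] linearApprox ψ y := by
    refine (Lp.coeFn_finsetSum _ _).trans ?_
    have h1 : ∀ᵐ t, ∀ m, (⟪ψ m, hy.toLp y⟫_ℝ • ψ m : L2Cube d) t
        = ⟪ψ m, hy.toLp y⟫_ℝ * ψ m t := by
      rw [ae_all_iff]
      intro m
      filter_upwards [Lp.coeFn_smul (⟪ψ m, hy.toLp y⟫_ℝ) (ψ m)] with t ht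
      simp [ht]
    filter_upwards [h1] with t ht
    rw [Finset.sum_apply, linearApprox]
    exact Finset.sum_congr rfl fun m _ => by rw [ht, inner_toLp_eq_integral]
  filter_upwards [Lp.coeFn_sub (hy.toLp y) (∑ m, ⟪ψ m, hy.toLp y⟫_ℝ • ψ m), hy.coeFn_toLp, hsum]
    with t h1 h2 h3
  rw [h1, Pi.sub_apply, h2, h3]

namespace IsCenteredField

lemma integral_mul_eq [IsProbabilityMeasure P] (h : IsCenteredField P Y K)
    (t s : Fin d → unitInterval) : ∫ ω, Y ω t * Y ω s ∂P = K t s := by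
  have := h.cov_eq t s
  rw [covariance_eq_sub (h.memLp t) (h.memLp s), h.mean_eq_zero, zero_mul, sub_zero] at this
  simpa using this

variable [IsProbabilityMeasure P] (h : IsCenteredField P Y K) (hT : ∀ t, K t t = T)

include h hT

lemma ae_memLp : ∀ᵐ ω ∂P, MemLp (Y ω) 2 volume :=
  ae_memLp_path h.aemeasurable h.memLp fun t => (h.integral_mul_eq t t).trans (hT t)

lemma lintegral_sq_inner (g : L2Cube d) :
    AEMeasurable (fun ω => ENNReal.ofReal ((∫ t, Y ω t * g t) ^ 2)) P ∧
    ∫⁻ ω, ENNReal.ofReal ((∫ t, Y ω t * g t) ^ 2) ∂P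
      = ENNReal.ofReal (∫ z : (Fin d → unitInterval) × (Fin d → unitInterval),
          K z.1 z.2 * (g z.1 * g z.2)) :=
  lintegral_sq_integral_mul h.aemeasurable h.memLp
    (fun t => (h.integral_mul_eq t t).trans (hT t)) h.integral_mul_eq
    ((Lp.memLp g).integrable one_le_two)

lemma lintegral_sq_eLpNorm : ∫⁻ ω, eLpNorm (Y ω) 2 volume ^ 2 ∂P = ENNReal.ofReal T := by
  simp_rw [eLpNorm_two_sq]
  exact lintegral_lintegral_enorm_sq h.aemeasurable h.memLp
    fun t => (h.integral_mul_eq t t).trans (hT t)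

lemma avgError_zero : avgError P Y 0 = (ENNReal.ofReal T) ^ (1 / 2 : ℝ) := by
  rw [← h.lintegral_sq_eLpNorm hT, avgError, iInf_unique]
  simp [linearApprox]

/-- Upper bound for the error by approximation with an orthonormal family. -/
lemma avgError_le {ι : Type*} {φ : ι → L2Cube d} (hφ : Orthonormal ℝ φ) (F : Finset ι)
    {lam : ι → ℝ} (h0 : ∀ i ∈ F, 0 ≤ lam i)
    (hq : ∀ i ∈ F, lam i ≤ ∫ z : (Fin d → unitInterval) × (Fin d → unitInterval),
      K z.1 z.2 * (φ i z.1 * φ i z.2)) :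
    avgError P Y F.card ≤ (ENNReal.ofReal (T - ∑ i ∈ F, lam i)) ^ (1 / 2 : ℝ) := by
  set ψ : Fin F.card → L2Cube d := fun m => φ (F.equivFin.symm m) with hψdef
  have hψ : Orthonormal ℝ ψ :=
    hφ.comp (fun m => (F.equivFin.symm m : ι))
      (Subtype.val_injective.comp F.equivFin.symm.injective)
  refine (iInf_le _ ψ).trans (ENNReal.rpow_le_rpow ?_ (by norm_num))
  have hsum : ∑ m, ENNReal.ofReal (lam (F.equivFin.symm m)) = ENNReal.ofReal (∑ i ∈ F, lam i) := by
    rw [ENNReal.ofReal_sum_of_nonneg h0,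
      F.equivFin.symm.sum_comp (fun i : F => ENNReal.ofReal (lam i)),
      Finset.sum_coe_sort F (fun i => ENNReal.ofReal (lam i))]
  have hle : ENNReal.ofReal (∑ i ∈ F, lam i)
      ≤ ∫⁻ ω, ∑ m, ENNReal.ofReal ((∫ t, Y ω t * ψ m t) ^ 2) ∂P := by
    rw [lintegral_finsetSum' _ fun m _ => (h.lintegral_sq_inner hT (ψ m)).1, ← hsum]
    refine Finset.sum_le_sum fun m _ => ?_
    rw [(h.lintegral_sq_inner hT (ψ m)).2]
    exact ENNReal.ofReal_le_ofReal (hq _ (F.equivFin.symm m).2)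
  have hadd : ∫⁻ ω, eLpNorm (fun t => Y ω t - linearApprox ψ (Y ω) t) 2 volume ^ 2 ∂P
      + ∫⁻ ω, ∑ m, ENNReal.ofReal ((∫ t, Y ω t * ψ m t) ^ 2) ∂P = ENNReal.ofReal T := by
    rw [← h.lintegral_sq_eLpNorm hT, ← lintegral_add_right' _
      (Finset.aemeasurable_fun_sum _ fun m _ => (h.lintegral_sq_inner hT (ψ m)).1)]
    refine lintegral_congr_ae ?_
    filter_upwards [h.ae_memLp hT] with ω hω
    have h1 := norm_sq_approxResidual_of_orthonormal hψ (hω.toLp (Y ω))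
    rw [eLpNorm_sub_linearApprox ψ hω, ← ENNReal.ofReal_sum_of_nonneg fun _ _ => sq_nonneg _,
      ← ENNReal.ofReal_add (by positivity) (by positivity), h1]
    simp only [inner_toLp_eq_integral, sub_add_cancel]
    rw [ENNReal.ofReal_pow (norm_nonneg _), ofReal_norm, Lp.enorm_toLp]
  rw [ENNReal.ofReal_sub _ (Finset.sum_nonneg h0)]
  refine ENNReal.le_sub_of_add_le_right ENNReal.ofReal_ne_top ?_
  rw [← hadd]
  gcongr

/-- Lower bound for the error of an arbitrary approximation of rank `n`. -/
lemma le_avgError {ι : Type*} {φ : ι → L2Cube d} (hφ : Orthonormal ℝ φ) (F : Finset ι)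
    {lam : ι → ℝ} {M : ℝ} (h0 : ∀ i ∈ F, 0 ≤ lam i) (hM : ∀ i ∈ F, lam i ≤ M) (hM0 : 0 ≤ M)
    (hq : ∀ g : L2Cube d, ∑ i ∈ F, lam i * ⟪φ i, g⟫_ℝ ^ 2
      ≤ ∫ z : (Fin d → unitInterval) × (Fin d → unitInterval),
      K z.1 z.2 * (g z.1 * g z.2)) (n : ℕ) :
    (ENNReal.ofReal (∑ i ∈ F, lam i - M * n)) ^ (1 / 2 : ℝ) ≤ avgError P Y n := by
  refine le_iInf fun ψ => ENNReal.rpow_le_rpow ?_ (by norm_num)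
  obtain ⟨N, b, hb, hpars⟩ := exists_orthonormal_parseval fun i : F => approxResidual ψ (φ i)
  calc ENNReal.ofReal (∑ i ∈ F, lam i - M * n)
      ≤ ENNReal.ofReal (∑ k, ∑ i ∈ F, lam i * ⟪φ i, approxResidual ψ (b k)⟫_ℝ ^ 2) := by
        refine ENNReal.ofReal_le_ofReal
          ((sum_mul_norm_sq_approxResidual_ge hφ ψ F h0 hM hM0).trans_eq ?_)
        rw [Finset.sum_comm]
        refine Finset.sum_congr rfl fun i hi => ?_
        rw [← hpars ⟨i, hi⟩, Finset.mul_sum]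
        refine Finset.sum_congr rfl fun k _ => ?_
        rw [← inner_approxResidual_comm, real_inner_comm]
    _ = ∑ k, ENNReal.ofReal (∑ i ∈ F, lam i * ⟪φ i, approxResidual ψ (b k)⟫_ℝ ^ 2) :=
        ENNReal.ofReal_sum_of_nonneg fun k _ =>
          Finset.sum_nonneg fun i hi => mul_nonneg (h0 i hi) (sq_nonneg _)
    _ ≤ ∑ k, ∫⁻ ω, ENNReal.ofReal ((∫ t, Y ω t * approxResidual ψ (b k) t) ^ 2) ∂P := by
        refine Finset.sum_le_sum fun k _ => ?_
        rw [(h.lintegral_sq_inner hT _).2]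
        exact ENNReal.ofReal_le_ofReal (hq _)
    _ = ∫⁻ ω, ∑ k, ENNReal.ofReal ((∫ t, Y ω t * approxResidual ψ (b k) t) ^ 2) ∂P :=
        (lintegral_finsetSum' _ fun k _ => (h.lintegral_sq_inner hT _).1).symm
    _ ≤ _ := by
        refine lintegral_mono_ae ?_
        filter_upwards [h.ae_memLp hT] with ω hω
        rw [eLpNorm_sub_linearApprox ψ hω, ← ENNReal.ofReal_sum_of_nonneg fun _ _ => sq_nonneg _]
        refine ENNReal.ofReal_le_ofReal ?_
        have h1 := hb.sum_inner_products_le (approxResidual ψ (hω.toLp (Y ω))) (s := Finset.univ)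
        refine le_trans (le_of_eq (Finset.sum_congr rfl fun k _ => ?_)) h1
        rw [← inner_approxResidual_comm, inner_toLp_eq_integral, Real.norm_eq_abs, sq_abs]

end IsCenteredField

end AvgError

/-! ### The Korobov kernel -/

section Korobov

open scoped InnerProductSpace

lemma integral_unitInterval (f : ℝ → ℝ) : ∫ t : unitInterval, f t = ∫ x in (0 : ℝ)..1, f x := by
  rw [intervalIntegral.integral_of_le zero_le_one, ← integral_Icc_eq_integral_Ioc]
  exact integral_subtype measurableSet_Icc f

lemma integral_cos_two_pi_mul_add {n : ℕ} (hn : n ≠ 0) (b : ℝ) :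
    ∫ t : unitInterval, Real.cos (2 * Real.pi * n * t + b) = 0 := by
  rw [integral_unitInterval fun x => Real.cos (2 * Real.pi * n * x + b),
    intervalIntegral.integral_comp_mul_add (f := Real.cos) (by positivity), integral_cos]
  have := Real.sin_add_nat_mul_two_pi b n
  rw [show 2 * Real.pi * n * 1 + b = b + n * (2 * Real.pi) by ring, this]
  simp

/-- `∑_{k ≥ 1} k ^ (-σ)`. -/
noncomputable def zetaSum (σ : ℝ) : ℝ := ∑' k : ℕ, ((k : ℝ) + 1) ^ (-σ)

lemma summable_rpow_neg {σ : ℝ} (hσ : 1 < σ) : Summable fun k : ℕ => ((k : ℝ) + 1) ^ (-σ) := by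
  have := (summable_nat_add_iff 1).2 (Real.summable_nat_rpow.2 (show -σ < -1 by linarith))
  simpa using this

lemma tendsto_zetaSum {σ : ℕ → ℝ} (hσ : Tendsto σ atTop atTop) :
    Tendsto (fun j => zetaSum (σ j)) atTop (𝓝 1) := by
  have h1 : ∑' k : ℕ, (if k = 0 then (1 : ℝ) else 0) = 1 := by simp
  rw [← h1]
  refine tendsto_tsum_of_dominated_convergence (summable_rpow_neg (σ := 2) one_lt_two) ?_ ?_
  · intro k
    rcases eq_or_ne k 0 with rfl | hk
    · simp
    · rw [if_neg hk]
      have hk1 : (1 : ℝ) < (k : ℝ) + 1 := by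
        have : (0 : ℝ) < k := by exact_mod_cast Nat.pos_of_ne_zero hk
        linarith
      exact (tendsto_rpow_atBot_of_base_gt_one _ hk1).comp (tendsto_neg_atTop_atBot.comp hσ)
  · filter_upwards [hσ.eventually_ge_atTop 2] with j hj k
    rw [Real.norm_of_nonneg (by positivity)]
    exact Real.rpow_le_rpow_of_exponent_le (by linarith [k.cast_nonneg (α := ℝ)]) (by linarith)

lemma one_le_zetaSum {σ : ℝ} (hσ : 1 < σ) : 1 ≤ zetaSum σ := by
  have := (summable_rpow_neg hσ).le_tsum 0 fun k _ => by positivity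
  simpa [zetaSum] using this

lemma korobovKernel_self (α β σ : ℝ) (t : unitInterval) :
    korobovKernel α β σ t t = α + 2 * β * zetaSum σ := by
  simp [korobovKernel, zetaSum]

lemma kernelTrace_korobovKernel (α β σ : ℝ) :
    kernelTrace (korobovKernel α β σ) = α + 2 * β * zetaSum σ := by
  simp [kernelTrace, korobovKernel_self]

lemma oneEigenvalue_korobovKernel (α β : ℝ) {σ : ℝ} (hσ : 1 < σ) :
    oneEigenvalue (korobovKernel α β σ) = α := by
  have hcont (t : unitInterval) (k : ℕ) : Continuous fun s : unitInterval =>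
      ((k : ℝ) + 1) ^ (-σ) * Real.cos (2 * Real.pi * ((k : ℝ) + 1) * ((t : ℝ) - (s : ℝ))) := by
    fun_prop
  have hint (t : unitInterval) (k : ℕ) := (hcont t k).integrable_of_hasCompactSupport
    (HasCompactSupport.of_compactSpace _) (μ := volume)
  have hbd (t s : unitInterval) (k : ℕ) :
      ‖((k : ℝ) + 1) ^ (-σ) * Real.cos (2 * Real.pi * ((k : ℝ) + 1) * ((t : ℝ) - (s : ℝ)))‖
        ≤ ((k : ℝ) + 1) ^ (-σ) := by
    rw [norm_mul, Real.norm_of_nonneg (by positivity)]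
    exact mul_le_of_le_one_right (by positivity) (Real.abs_cos_le_one _)
  have hzero (t : unitInterval) (k : ℕ) : ∫ s : unitInterval,
      ((k : ℝ) + 1) ^ (-σ) * Real.cos (2 * Real.pi * ((k : ℝ) + 1) * ((t : ℝ) - (s : ℝ))) = 0 := by
    rw [integral_const_mul]
    have h := integral_cos_two_pi_mul_add k.succ_ne_zero (-(2 * Real.pi * ((k : ℝ) + 1) * t))
    have h2 : ∀ s : unitInterval, Real.cos (2 * Real.pi * ((k : ℝ) + 1) * ((t : ℝ) - (s : ℝ)))
        = Real.cos (2 * Real.pi * (k.succ : ℕ) * s + -(2 * Real.pi * ((k : ℝ) + 1) * t)) := by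
      intro s
      rw [← Real.cos_neg]
      congr 1
      push_cast
      ring
    simp only [h2, h, mul_zero]
  have hrow (t : unitInterval) : ∫ s, korobovKernel α β σ t s = α := by
    have hs : Summable fun k : ℕ => ∫ s : unitInterval,
        ‖((k : ℝ) + 1) ^ (-σ) * Real.cos (2 * Real.pi * ((k : ℝ) + 1) * ((t : ℝ) - (s : ℝ)))‖ := by
      refine Summable.of_nonneg_of_le (fun k => integral_nonneg fun s => norm_nonneg _)
        (fun k => ?_) (summable_rpow_neg hσ)
      refine (integral_mono (hint t k).norm (integrable_const _) fun s => hbd t s k).trans ?_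
      simp
    have h1 := hasSum_integral_of_summable_integral_norm (hint t) hs
    simp only [hzero] at h1
    have h2 := h1.unique hasSum_zero
    have hc : Continuous fun s : unitInterval => ∑' k : ℕ,
        ((k : ℝ) + 1) ^ (-σ) * Real.cos (2 * Real.pi * ((k : ℝ) + 1) * ((t : ℝ) - (s : ℝ))) :=
      continuous_tsum (hcont t) (summable_rpow_neg hσ) fun k s => hbd t s k
    simp only [korobovKernel]
    rw [integral_add (integrable_const _) ((hc.integrable_of_hasCompactSupport
      (HasCompactSupport.of_compactSpace _)).const_mul _), integral_const_mul, h2]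
    simp
  simp [oneEigenvalue, hrow]

lemma continuous_korobovKernel (α β : ℝ) {σ : ℝ} (hσ : 1 < σ) :
    Continuous fun z : unitInterval × unitInterval => korobovKernel α β σ z.1 z.2 := by
  refine continuous_const.add (continuous_const.mul
    (continuous_tsum (fun k => by fun_prop) (summable_rpow_neg hσ) fun k z => ?_))
  rw [norm_mul, Real.norm_of_nonneg (by positivity)]
  exact mul_le_of_le_one_right (by positivity) (Real.abs_cos_le_one _)

/-- The two normalized harmonics of period one, `√2 cos (2 π x)` and `√2 sin (2 π x)`. -/
noncomputable def unitHarmonic (b : Bool) (x : ℝ) : ℝ :=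
  √2 * Real.cos (2 * Real.pi * x + cond b 0 (-(Real.pi / 2)))

lemma continuous_unitHarmonic (b : Bool) : Continuous (unitHarmonic b) := by
  unfold unitHarmonic
  fun_prop

section Quadratic

variable {X : Type*} [MeasurableSpace X] {μ : Measure X} {p : X → unitInterval} {g : X → ℝ}

lemma integrable_korobovKernel_mul (hp : Measurable p) (hg : Integrable g μ) (α β : ℝ) {σ : ℝ}
    (hσ : 1 < σ) :
    Integrable (fun z : X × X => korobovKernel α β σ (p z.1) (p z.2) * (g z.1 * g z.2))
      (μ.prod μ) := by
  have hc := continuous_korobovKernel α β hσ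
  obtain ⟨C, hC⟩ := isCompact_univ.exists_bound_of_continuousOn hc.continuousOn
  refine (hg.mul_prod hg).bdd_mul (c := C) ?_ (Eventually.of_forall fun z => hC (p z.1, p z.2) trivial)
  exact (hc.measurable.comp
    ((hp.comp measurable_fst).prodMk (hp.comp measurable_snd))).aestronglyMeasurable

lemma integral_cos_sub_mul [SFinite μ] (hp : Measurable p) (hg : Integrable g μ) (a : ℝ) :
    ∫ z : X × X, Real.cos (a * ((p z.1 : ℝ) - p z.2)) * (g z.1 * g z.2) ∂(μ.prod μ)
      = (∫ t, Real.cos (a * p t) * g t ∂μ) ^ 2 + (∫ t, Real.sin (a * p t) * g t ∂μ) ^ 2 := by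
  have hc : Integrable (fun t => Real.cos (a * p t) * g t) μ :=
    hg.bdd_mul (c := 1) (by fun_prop) (Eventually.of_forall fun t => Real.abs_cos_le_one _)
  have hs : Integrable (fun t => Real.sin (a * p t) * g t) μ :=
    hg.bdd_mul (c := 1) (by fun_prop) (Eventually.of_forall fun t => Real.abs_sin_le_one _)
  rw [sq, sq, ← integral_prod_mul (fun t => Real.cos (a * p t) * g t),
    ← integral_prod_mul (fun t => Real.sin (a * p t) * g t),
    ← integral_add (hc.mul_prod hc) (hs.mul_prod hs)]
  refine integral_congr_ae (Eventually.of_forall fun z => ?_)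
  simp only [mul_sub, Real.cos_sub]
  ring

/-- The quadratic form of the Korobov kernel dominates the part of its spectral decomposition
that belongs to the frequencies zero and one. -/
lemma korobovKernel_quadratic_ge [SFinite μ] (hp : Measurable p) (hg : Integrable g μ) (α : ℝ) {β σ : ℝ}
    (hβ : 0 ≤ β) (hσ : 1 < σ) :
    α * (∫ t, g t ∂μ) ^ 2 + ∑ b, β * (∫ t, unitHarmonic b (p t) * g t ∂μ) ^ 2
      ≤ ∫ z : X × X, korobovKernel α β σ (p z.1) (p z.2) * (g z.1 * g z.2) ∂(μ.prod μ) := by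
  set F : ℕ → X × X → ℝ := fun k z => ((k : ℝ) + 1) ^ (-σ) *
    Real.cos (2 * Real.pi * ((k : ℝ) + 1) * ((p z.1 : ℝ) - p z.2)) * (g z.1 * g z.2) with hF
  have hgg := hg.mul_prod hg
  have hbd (k : ℕ) (z : X × X) : ‖((k : ℝ) + 1) ^ (-σ) *
      Real.cos (2 * Real.pi * ((k : ℝ) + 1) * ((p z.1 : ℝ) - p z.2))‖ ≤ ((k : ℝ) + 1) ^ (-σ) := by
    rw [norm_mul, Real.norm_of_nonneg (by positivity)]
    exact mul_le_of_le_one_right (by positivity) (Real.abs_cos_le_one _)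
  have hFi (k : ℕ) : Integrable (F k) (μ.prod μ) :=
    hgg.bdd_mul (by fun_prop) (Eventually.of_forall fun z => hbd k z)
  have hFs : Summable fun k => ∫ z, ‖F k z‖ ∂(μ.prod μ) := by
    refine Summable.of_nonneg_of_le (fun k => integral_nonneg fun s => norm_nonneg _)
      (fun k => ?_) ((summable_rpow_neg hσ).mul_right (∫ z, ‖g z.1 * g z.2‖ ∂(μ.prod μ)))
    rw [← integral_const_mul]
    refine integral_mono (hFi k).norm (hgg.norm.const_mul _) fun z => ?_
    simp only [hF]
    rw [norm_mul]
    exact mul_le_mul_of_nonneg_right (hbd k z) (norm_nonneg _)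
  have hval (k : ℕ) : ∫ z, F k z ∂(μ.prod μ) = ((k : ℝ) + 1) ^ (-σ) *
      ((∫ t, Real.cos (2 * Real.pi * ((k : ℝ) + 1) * p t) * g t ∂μ) ^ 2
        + (∫ t, Real.sin (2 * Real.pi * ((k : ℝ) + 1) * p t) * g t ∂μ) ^ 2) := by
    rw [← integral_cos_sub_mul hp hg, ← integral_const_mul]
    simp only [hF, mul_assoc]
  have hsum := hasSum_integral_of_summable_integral_norm hFi hFs
  have h0 := le_hasSum hsum 0 fun k _ => by rw [hval]; positivity
  have hsplit : ∀ z : X × X, korobovKernel α β σ (p z.1) (p z.2) * (g z.1 * g z.2)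
      = α * (g z.1 * g z.2) + 2 * β * ∑' k, F k z := by
    intro z
    simp only [hF, korobovKernel, tsum_mul_right]
    ring
  have hK := integrable_korobovKernel_mul hp hg 0 (1 / 2) hσ
  have hFint : Integrable (fun z => ∑' k, F k z) (μ.prod μ) := by
    refine hK.congr (Eventually.of_forall fun z => ?_)
    simp only [hF, korobovKernel, tsum_mul_right]
    ring
  simp only [hsplit]
  rw [integral_add (hgg.const_mul _) (hFint.const_mul _), integral_const_mul, integral_const_mul,
    integral_prod_mul g g, ← sq]
  have hcos : ∫ t, unitHarmonic true (p t) * g t ∂μ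
      = √2 * ∫ t, Real.cos (2 * Real.pi * p t) * g t ∂μ := by
    rw [← integral_const_mul]
    simp only [unitHarmonic, cond_true, add_zero, mul_assoc]
  have hsin : ∫ t, unitHarmonic false (p t) * g t ∂μ
      = √2 * ∫ t, Real.sin (2 * Real.pi * p t) * g t ∂μ := by
    rw [← integral_const_mul]
    simp only [unitHarmonic, cond_false, ← sub_eq_add_neg, Real.cos_sub_pi_div_two, mul_assoc]
  rw [Fintype.sum_bool, hcos, hsin, mul_pow, mul_pow, Real.sq_sqrt zero_le_two]
  rw [hval] at h0
  simp only [Nat.cast_zero, zero_add, mul_one, Real.one_rpow, one_mul] at h0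
  have := mul_le_mul_of_nonneg_left h0 hβ
  linarith

lemma sum_korobovKernel_quadratic_ge [SFinite μ] {ι : Type*} [Fintype ι] {p : ι → X → unitInterval}
    (hp : ∀ j, Measurable (p j)) (hg : Integrable g μ) (α : ι → ℝ) {β σ : ι → ℝ}
    (hβ : ∀ j, 0 ≤ β j) (hσ : ∀ j, 1 < σ j) :
    ∑ j, (α j * (∫ t, g t ∂μ) ^ 2 + ∑ b, β j * (∫ t, unitHarmonic b (p j t) * g t ∂μ) ^ 2)
      ≤ ∫ z : X × X, (∑ j, korobovKernel (α j) (β j) (σ j) (p j z.1) (p j z.2)) * (g z.1 * g z.2)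
        ∂(μ.prod μ) := by
  simp only [Finset.sum_mul]
  rw [integral_finsetSum _ fun j _ => integrable_korobovKernel_mul (hp j) hg _ _ (hσ j)]
  exact Finset.sum_le_sum fun j _ => korobovKernel_quadratic_ge (hp j) hg _ (hβ j) (hσ j)

end Quadratic

lemma integral_unitHarmonic (b : Bool) : ∫ t : unitInterval, unitHarmonic b t = 0 := by
  have := integral_cos_two_pi_mul_add one_ne_zero (cond b 0 (-(Real.pi / 2)))
  simp only [Nat.cast_one, mul_one] at this
  simp [unitHarmonic, integral_const_mul, this]

lemma integral_unitHarmonic_mul (b b' : Bool) :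
    ∫ t : unitInterval, unitHarmonic b t * unitHarmonic b' t = if b = b' then 1 else 0 := by
  set q : Bool → ℝ := fun b => cond b 0 (-(Real.pi / 2)) with hq
  have h1 (t : unitInterval) : unitHarmonic b t * unitHarmonic b' t
      = Real.cos (2 * Real.pi * (2 : ℕ) * t + (q b + q b')) + Real.cos (q b - q b') := by
    have h2 : unitHarmonic b t * unitHarmonic b' t
        = √2 ^ 2 * (Real.cos (2 * Real.pi * t + q b) * Real.cos (2 * Real.pi * t + q b')) := by
      simp only [unitHarmonic, hq]
      ring
    rw [h2, Real.sq_sqrt zero_le_two, show 2 * Real.pi * (2 : ℕ) * t + (q b + q b')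
      = (2 * Real.pi * t + q b) + (2 * Real.pi * t + q b') by push_cast; ring,
      show q b - q b' = (2 * Real.pi * t + q b) - (2 * Real.pi * t + q b') by ring,
      Real.cos_add (2 * Real.pi * t + q b), Real.cos_sub]
    ring
  simp only [h1]
  rw [integral_add _ (integrable_const _), integral_cos_two_pi_mul_add two_ne_zero]
  · cases b <;> cases b' <;> simp [hq]
  · exact Continuous.integrable_of_hasCompactSupport (by fun_prop)
      (HasCompactSupport.of_compactSpace _)

/-! ### The eigenfunctions on the cube -/

/-- The constant function and the harmonics of period one in each of the coordinates. -/
noncomputable def cubeHarmonic (d : ℕ) : Option (Fin d × Bool) → (Fin d → unitInterval) → ℝ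
  | none, _ => 1
  | some (j, b), t => unitHarmonic b (t j)

lemma continuous_cubeHarmonic {d : ℕ} (i : Option (Fin d × Bool)) :
    Continuous (cubeHarmonic d i) := by
  rcases i with _ | ⟨j, b⟩
  · exact continuous_const
  · exact (continuous_unitHarmonic b).comp (by fun_prop)

lemma memLp_cubeHarmonic {d : ℕ} (i : Option (Fin d × Bool)) :
    MemLp (cubeHarmonic d i) 2 volume :=
  (continuous_cubeHarmonic i).memLp_of_hasCompactSupport (HasCompactSupport.of_compactSpace _)

lemma integral_eval_cube {d : ℕ} (j : Fin d) {f : unitInterval → ℝ} (hf : Continuous f) :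
    ∫ t : Fin d → unitInterval, f (t j) = ∫ x, f x := by
  have hmp : MeasurePreserving (Function.eval j) (volume : Measure (Fin d → unitInterval))
      volume := measurePreserving_eval (fun _ : Fin d => (volume : Measure unitInterval)) j
  rw [← hmp.map_eq]
  exact (integral_map hmp.measurable.aemeasurable hf.aestronglyMeasurable).symm

lemma integral_cubeHarmonic_mul {d : ℕ} (i i' : Option (Fin d × Bool)) :
    ∫ t, cubeHarmonic d i t * cubeHarmonic d i' t = if i = i' then 1 else 0 := by
  have hh (b : Bool) : Continuous fun x : unitInterval => unitHarmonic b x :=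
    (continuous_unitHarmonic b).comp continuous_subtype_val
  rcases i with _ | ⟨j, b⟩ <;> rcases i' with _ | ⟨j', b'⟩
  · simp [cubeHarmonic]
  · simpa [cubeHarmonic, integral_unitHarmonic] using integral_eval_cube j' (hh b')
  · simpa [cubeHarmonic, integral_unitHarmonic] using integral_eval_cube j (hh b)
  · simp only [cubeHarmonic, Option.some.injEq, Prod.mk.injEq]
    by_cases hj : j = j'
    · subst hj
      rw [integral_eval_cube j (f := fun x => unitHarmonic b x * unitHarmonic b' x)
        ((hh b).mul (hh b')), integral_unitHarmonic_mul]
      simp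
    · have hind := (iIndepFun_pi (μ := fun _ : Fin d => (volume : Measure unitInterval))
        (X := fun _ x => x) fun _ => aemeasurable_id).indepFun hj
      have := (hind.comp (hh b).measurable (hh b').measurable).integral_mul_eq_mul_integral
        (((hh b).comp (continuous_apply j)).aestronglyMeasurable)
        (((hh b').comp (continuous_apply j')).aestronglyMeasurable)
      refine this.trans ?_
      have h1 := integral_eval_cube j (hh b)
      rw [integral_unitHarmonic] at h1
      rw [if_neg fun h => hj h.1]
      exact mul_eq_zero_of_left h1 _

/-- `cubeHarmonic` as an element of `L₂([0,1]^d)`. -/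
noncomputable def cubeBasis (d : ℕ) (i : Option (Fin d × Bool)) : L2Cube d :=
  (memLp_cubeHarmonic i).toLp _

lemma inner_cubeBasis {d : ℕ} (i : Option (Fin d × Bool)) (g : L2Cube d) :
    ⟪cubeBasis d i, g⟫_ℝ = ∫ t, cubeHarmonic d i t * g t := by
  rw [real_inner_comm]
  exact inner_toLp_eq_integral _ g

lemma orthonormal_cubeBasis (d : ℕ) : Orthonormal ℝ (cubeBasis d) := by
  classical
  rw [orthonormal_iff_ite]
  intro i i'
  rw [inner_cubeBasis, ← integral_cubeHarmonic_mul]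
  refine integral_congr_ae ?_
  filter_upwards [(memLp_cubeHarmonic i').coeFn_toLp] with t ht
  rw [cubeBasis, ht]

/-- The eigenvalues that belong to `cubeHarmonic`. -/
noncomputable def cubeEigenvalue (α β : ℕ → ℝ) (d : ℕ) : Option (Fin d × Bool) → ℝ
  | none => ∑ j : Fin d, α ((j : ℕ) + 1)
  | some (j, _) => β ((j : ℕ) + 1)

variable {α β σ : ℕ → ℝ} (hα : ∀ j, 1 ≤ j → 0 < α j) (hβ : ∀ j, 1 ≤ j → 0 < β j)
  (hσ : ∀ j, 1 ≤ j → 1 < σ j)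

include hα hβ in
lemma cubeEigenvalue_nonneg {d : ℕ} (i : Option (Fin d × Bool)) : 0 ≤ cubeEigenvalue α β d i := by
  rcases i with _ | ⟨j, b⟩
  · exact Finset.sum_nonneg fun j _ => (hα _ (by omega)).le
  · exact (hβ _ (by omega)).le

include hβ hσ in
lemma sum_cubeEigenvalue_mul_le {d : ℕ} (g : L2Cube d) :
    ∑ i, cubeEigenvalue α β d i * ⟪cubeBasis d i, g⟫_ℝ ^ 2
      ≤ ∫ z : (Fin d → unitInterval) × (Fin d → unitInterval),
        additiveKernel (fun j => korobovKernel (α j) (β j) (σ j)) d z.1 z.2 * (g z.1 * g z.2) := by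
  have h := sum_korobovKernel_quadratic_ge (p := fun (j : Fin d) t => t j) (fun j => measurable_pi_apply j)
    ((Lp.memLp g).integrable one_le_two) (fun j => α ((j : ℕ) + 1))
    (fun j : Fin d => (hβ ((j : ℕ) + 1) (by omega)).le) fun j => hσ ((j : ℕ) + 1) (by omega)
  refine le_trans (le_of_eq ?_) h
  rw [Fintype.sum_option, Fintype.sum_prod_type]
  simp only [inner_cubeBasis, cubeHarmonic, cubeEigenvalue, one_mul]
  rw [Finset.sum_mul, ← Finset.sum_add_distrib]

end Korobov

/-! ### Two-sided bounds for the approximation complexity -/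

section Complexity

lemma sum_fin_succ_eq_sum_Icc (f : ℕ → ℝ) (d : ℕ) :
    ∑ j : Fin d, f ((j : ℕ) + 1) = ∑ j ∈ Finset.Icc 1 d, f j := by
  induction d with
  | zero => simp
  | succ d ih => rw [Fin.sum_univ_castSucc, Finset.sum_Icc_succ_top (by omega), ← ih]; simp

lemma sum_fin_filter_lt (f : ℕ → ℝ) {m d : ℕ} (hmd : m ≤ d) :
    ∑ j ∈ Finset.univ.filter fun j : Fin d => (j : ℕ) < m, f ((j : ℕ) + 1) = ∑ j ∈ Finset.Icc 1 m, f j := by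
  rw [Finset.sum_filter]
  have := sum_fin_succ_eq_sum_Icc (fun j => if j ≤ m then f j else 0) d
  simp only [Nat.succ_le_iff] at this
  rw [this, ← Finset.sum_filter]
  congr 1
  ext j
  simp only [Finset.mem_filter, Finset.mem_Icc]
  omega

lemma sum_fin_filter_not_lt (f : ℕ → ℝ) {m d : ℕ} (hmd : m ≤ d) :
    ∑ j ∈ Finset.univ.filter fun j : Fin d => ¬ (j : ℕ) < m, f ((j : ℕ) + 1)
      = ∑ j ∈ Finset.Icc 1 d, f j - ∑ j ∈ Finset.Icc 1 m, f j := by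
  rw [← sum_fin_succ_eq_sum_Icc f d, ← sum_fin_filter_lt f hmd, eq_sub_iff_add_eq', add_comm,
    add_comm, Finset.sum_filter_add_sum_filter_not]

lemma ofReal_mul_sqrt_ofReal {ε : ℝ} (hε : 0 ≤ ε) (T : ℝ) :
    ENNReal.ofReal ε * (ENNReal.ofReal T) ^ (1 / 2 : ℝ)
      = (ENNReal.ofReal (ε ^ 2 * T)) ^ (1 / 2 : ℝ) := by
  rw [ENNReal.ofReal_mul (sq_nonneg ε), ENNReal.mul_rpow_of_nonneg _ _ (by norm_num),
    ENNReal.ofReal_pow hε, ← ENNReal.rpow_natCast, ← ENNReal.rpow_mul]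
  norm_num

variable {α β σ : ℕ → ℝ} (hα : ∀ j, 1 ≤ j → 0 < α j) (hβ : ∀ j, 1 ≤ j → 0 < β j)
  (hσ : ∀ j, 1 ≤ j → 1 < σ j) {Ω : Type*} [MeasurableSpace Ω] {P : Measure Ω}
  [IsProbabilityMeasure P] {d : ℕ} {Y : Ω → (Fin d → unitInterval) → ℝ}
  (hY : IsCenteredField P Y (additiveKernel (fun j => korobovKernel (α j) (β j) (σ j)) d))

lemma additiveKernel_korobovKernel_self (α β σ : ℕ → ℝ) (t : Fin d → unitInterval) :
    additiveKernel (fun j => korobovKernel (α j) (β j) (σ j)) d t t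
      = ∑ j ∈ Finset.Icc 1 d, (α j + 2 * β j * zetaSum (σ j)) := by
  simp only [additiveKernel, korobovKernel_self]
  exact sum_fin_succ_eq_sum_Icc (fun j => α j + 2 * β j * zetaSum (σ j)) d

include hα hβ hσ hY

/-- The constant and `m` pairs of harmonics suffice if the remaining trace is small. -/
lemma avgError_two_mul_add_one_le {ε : ℝ} (hε : 0 ≤ ε) {m : ℕ} (hmd : m ≤ d)
    (hm : ∑ j ∈ Finset.Icc 1 d, (α j + 2 * β j * zetaSum (σ j)) - ∑ j ∈ Finset.Icc 1 d, α j
      - 2 * ∑ j ∈ Finset.Icc 1 m, β j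
      ≤ ε ^ 2 * ∑ j ∈ Finset.Icc 1 d, (α j + 2 * β j * zetaSum (σ j))) :
    avgError P Y (2 * m + 1) ≤ ENNReal.ofReal ε * avgError P Y 0 := by
  classical
  have hT := additiveKernel_korobovKernel_self (d := d) α β σ
  set F : Finset (Option (Fin d × Bool)) :=
    Finset.insertNone ((Finset.univ.filter fun j : Fin d => (j : ℕ) < m) ×ˢ Finset.univ) with hF
  have hcard : F.card = 2 * m + 1 := by
    have h1 := sum_fin_filter_lt (fun _ => 1) hmd
    simp only [Finset.sum_const, nsmul_eq_mul, mul_one, Nat.card_Icc, Nat.add_sub_cancel,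
      Nat.cast_inj] at h1
    rw [hF, Finset.card_insertNone, Finset.card_product, h1, Finset.card_univ, Fintype.card_bool]
    ring
  have hsum : ∑ i ∈ F, cubeEigenvalue α β d i
      = ∑ j ∈ Finset.Icc 1 d, α j + 2 * ∑ j ∈ Finset.Icc 1 m, β j := by
    rw [hF, Finset.sum_insertNone, Finset.sum_product]
    simp only [cubeEigenvalue, Finset.sum_const, Finset.card_univ, Fintype.card_bool]
    rw [sum_fin_succ_eq_sum_Icc, ← Finset.smul_sum, sum_fin_filter_lt β hmd]
    simp
  have h := hY.avgError_le hT (orthonormal_cubeBasis d) F (lam := cubeEigenvalue α β d)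
    (fun i _ => cubeEigenvalue_nonneg hα hβ i) fun i _ => by
      refine le_trans (le_of_eq ?_) (sum_cubeEigenvalue_mul_le hβ hσ (cubeBasis d i))
      simp [orthonormal_iff_ite.1 (orthonormal_cubeBasis d)]
  rw [hcard, hsum] at h
  rw [hY.avgError_zero hT, ofReal_mul_sqrt_ofReal hε]
  refine h.trans (ENNReal.rpow_le_rpow (ENNReal.ofReal_le_ofReal ?_) (by norm_num))
  linarith

/-- Any approximation with relative error `ε` has large rank if the trace of the harmonics beyond
the coordinate `m` is large. -/
lemma sum_sub_le_of_avgError_le {ε M : ℝ} (hε : 0 ≤ ε) (hM : 0 ≤ M) {m n : ℕ} (hmd : m ≤ d)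
    (hβM : ∀ j, m < j → β j ≤ M)
    (hn : avgError P Y n ≤ ENNReal.ofReal ε * avgError P Y 0) :
    2 * (∑ j ∈ Finset.Icc 1 d, β j - ∑ j ∈ Finset.Icc 1 m, β j) - M * n
      ≤ ε ^ 2 * ∑ j ∈ Finset.Icc 1 d, (α j + 2 * β j * zetaSum (σ j)) := by
  classical
  have hT := additiveKernel_korobovKernel_self (d := d) α β σ
  set F : Finset (Option (Fin d × Bool)) :=
    ((Finset.univ.filter fun j : Fin d => ¬ (j : ℕ) < m) ×ˢ Finset.univ).map
      Function.Embedding.some with hF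
  have hsum : ∑ i ∈ F, cubeEigenvalue α β d i
      = 2 * (∑ j ∈ Finset.Icc 1 d, β j - ∑ j ∈ Finset.Icc 1 m, β j) := by
    rw [hF, Finset.sum_map, Finset.sum_product]
    simp only [cubeEigenvalue, Finset.sum_const, Finset.card_univ, Fintype.card_bool,
      Function.Embedding.some_apply]
    rw [← Finset.smul_sum, sum_fin_filter_not_lt β hmd]
    simp
  have h := hY.le_avgError hT (orthonormal_cubeBasis d) F (lam := cubeEigenvalue α β d) (M := M)
    (fun i _ => cubeEigenvalue_nonneg hα hβ i) (fun i hi => by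
      simp only [hF, Finset.mem_map, Finset.mem_product, Finset.mem_filter, Finset.mem_univ,
        true_and, and_true] at hi
      obtain ⟨⟨j, b⟩, hj, rfl⟩ := hi
      exact hβM _ (by simp only at hj; omega)) hM
    (fun g => (Finset.sum_le_univ_sum_of_nonneg fun i =>
      mul_nonneg (cubeEigenvalue_nonneg hα hβ i) (sq_nonneg _)).trans
        (sum_cubeEigenvalue_mul_le hβ hσ g)) n
  have hT0 : 0 ≤ ∑ j ∈ Finset.Icc 1 d, (α j + 2 * β j * zetaSum (σ j)) :=
    Finset.sum_nonneg fun j hj => by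
      have hj1 := (Finset.mem_Icc.1 hj).1
      have := one_le_zetaSum (hσ j hj1)
      have := hα j hj1
      have := hβ j hj1
      positivity
  rw [hY.avgError_zero hT, ofReal_mul_sqrt_ofReal hε] at hn
  rw [hsum] at h
  have h2 := (ENNReal.rpow_le_rpow_iff (by norm_num)).1 (h.trans hn)
  exact (ENNReal.ofReal_le_ofReal_iff (by positivity)).1 h2

end Complexity

/-! ### Asymptotics -/

section Asymptotic

lemma tendsto_log_natCast : Tendsto (fun d : ℕ => Real.log d) atTop atTop :=
  Real.tendsto_log_atTop.comp tendsto_natCast_atTop_atTop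

lemma tendsto_harmonic_div_log :
    Tendsto (fun d : ℕ => (harmonic d : ℝ) / Real.log d) atTop (𝓝 1) := by
  have h := (Real.tendsto_harmonic_sub_log.div_atTop tendsto_log_natCast).add_const 1
  rw [zero_add] at h
  refine h.congr' ?_
  filter_upwards [tendsto_log_natCast.eventually_gt_atTop 0] with d hd
  field_simp
  ring

/-- If `j f(j) → l`, then `f(1) + ⋯ + f(d) = l ln d + o(ln d)`. -/
lemma tendsto_sum_div_log {f : ℕ → ℝ} {l : ℝ} (hf : Tendsto (fun j : ℕ => f j * j) atTop (𝓝 l)) :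
    Tendsto (fun d : ℕ => (∑ j ∈ Finset.Icc 1 d, f j) / Real.log d) atTop (𝓝 l) := by
  set g : ℕ → ℝ := fun i => ((i : ℝ) + 1)⁻¹ with hg
  have hgsum (d : ℕ) : ∑ i ∈ Finset.range d, g i = harmonic d := by
    simp [hg, harmonic]
  have hfsum (d : ℕ) : ∑ j ∈ Finset.Icc 1 d, f j = ∑ i ∈ Finset.range d, f (i + 1) := by
    rw [← sum_fin_succ_eq_sum_Icc]
    exact Fin.sum_univ_eq_sum_range (fun i => f (i + 1)) d
  have hg0 (i : ℕ) : 0 < g i := by positivity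
  have ho : (fun i => f (i + 1) - l * g i) =o[atTop] g := by
    rw [isLittleO_iff_tendsto fun i hi => absurd hi (hg0 i).ne']
    have h1 := ((tendsto_add_atTop_iff_nat 1).2 hf).sub_const l
    rw [sub_self] at h1
    refine h1.congr fun i => ?_
    have : (i : ℝ) + 1 ≠ 0 := by positivity
    simp only [hg]
    push_cast
    field_simp
  have hratio := tendsto_harmonic_div_log
  have hHtop : Tendsto (fun d => ∑ i ∈ Finset.range d, g i) atTop atTop := by
    simp only [hgsum]
    refine tendsto_atTop_mono' _ ?_ tendsto_log_natCast
    filter_upwards [eventually_gt_atTop 0] with d hd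
    refine le_trans (Real.log_le_log (by exact_mod_cast hd) ?_) (log_add_one_le_harmonic d)
    push_cast
    linarith
  have h2 := (ho.sum_range (fun i => (hg0 i).le) hHtop).tendsto_div_nhds_zero
  have h3 := (h2.mul hratio).add (hratio.const_mul l)
  rw [zero_mul, zero_add, mul_one] at h3
  refine h3.congr' ?_
  filter_upwards [hHtop.eventually_gt_atTop 0] with d hd
  rw [Finset.sum_sub_distrib, ← Finset.mul_sum, hfsum]
  rw [hgsum] at hd ⊢
  field_simp
  ring

lemma eventually_half_rpow_le_floor {a : ℝ} (ha : 0 < a) :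
    ∀ᶠ d : ℕ in atTop, (d : ℝ) ^ a / 2 ≤ ⌊(d : ℝ) ^ a⌋₊ ∧ 1 ≤ ⌊(d : ℝ) ^ a⌋₊ := by
  filter_upwards [((tendsto_rpow_atTop ha).comp tendsto_natCast_atTop_atTop).eventually_ge_atTop 2]
    with d hd
  simp only [Function.comp_apply] at hd
  refine ⟨?_, Nat.le_floor (by push_cast; linarith)⟩
  linarith [Nat.lt_floor_add_one ((d : ℝ) ^ a)]

lemma tendsto_floor_rpow {a : ℝ} (ha : 0 < a) :
    Tendsto (fun d : ℕ => ⌊(d : ℝ) ^ a⌋₊) atTop atTop :=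
  tendsto_nat_floor_atTop.comp ((tendsto_rpow_atTop ha).comp tendsto_natCast_atTop_atTop)

lemma tendsto_log_floor_rpow_div_log {a : ℝ} (ha : 0 < a) :
    Tendsto (fun d : ℕ => Real.log ⌊(d : ℝ) ^ a⌋₊ / Real.log d) atTop (𝓝 a) := by
  have hlow : Tendsto (fun d : ℕ => a - Real.log 2 / Real.log d) atTop (𝓝 a) := by
    simpa using (tendsto_const_nhds (x := Real.log 2)).div_atTop tendsto_log_natCast |>.const_sub a
  refine tendsto_of_tendsto_of_tendsto_of_le_of_le' hlow tendsto_const_nhds ?_ ?_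
  · filter_upwards [eventually_half_rpow_le_floor ha, eventually_gt_atTop 0,
      tendsto_log_natCast.eventually_gt_atTop 0] with d hd hd0 hL
    have hd0' : (0 : ℝ) < d := by exact_mod_cast hd0
    have h := Real.log_le_log (by positivity) hd.1
    rw [Real.log_div (by positivity) two_ne_zero, Real.log_rpow hd0'] at h
    rw [le_div_iff₀ hL, sub_mul, div_mul_cancel₀ _ hL.ne']
    exact h
  · filter_upwards [eventually_half_rpow_le_floor ha, eventually_gt_atTop 0,
      tendsto_log_natCast.eventually_gt_atTop 0] with d hd hd0 hL
    have hd0' : (0 : ℝ) < d := by exact_mod_cast hd0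
    have h := Real.log_le_log (by exact_mod_cast hd.2) (Nat.floor_le (by positivity : 0 ≤ (d : ℝ) ^ a))
    rw [Real.log_rpow hd0'] at h
    rwa [div_le_iff₀ hL]

lemma tendsto_sum_floor_rpow_div_log {f : ℕ → ℝ} {l a : ℝ} (ha : 0 < a)
    (hf : Tendsto (fun j : ℕ => f j * j) atTop (𝓝 l)) :
    Tendsto (fun d : ℕ => (∑ j ∈ Finset.Icc 1 ⌊(d : ℝ) ^ a⌋₊, f j) / Real.log d) atTop
      (𝓝 (l * a)) := by
  have h := ((tendsto_sum_div_log hf).comp (tendsto_floor_rpow ha)).mul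
    (tendsto_log_floor_rpow_div_log ha)
  refine h.congr' ?_
  filter_upwards [(tendsto_log_natCast.comp (tendsto_floor_rpow ha)).eventually_gt_atTop 0]
    with d hd
  simp only [Function.comp_apply] at hd ⊢
  field_simp

lemma isLittleO_log_of_rpow_bounds {N : ℕ → ℕ} {θ : ℝ} (hθ : θ ∈ Set.Ioo (0 : ℝ) 1)
    (hup : ∀ a ∈ Set.Ioo θ 1, ∀ᶠ d : ℕ in atTop, N d ≤ 2 * ⌊(d : ℝ) ^ a⌋₊ + 1)
    (hlow : ∀ a ∈ Set.Ioo 0 θ, ∀ᶠ d : ℕ in atTop, (d : ℝ) ^ a ≤ N d) :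
    (fun d : ℕ => Real.log (N d) - θ * Real.log d) =o[atTop] fun d : ℕ => Real.log d := by
  obtain ⟨hθ0, hθ1⟩ := hθ
  rw [isLittleO_iff]
  intro δ hδ
  have h1 : min (θ + δ / 2) ((θ + 1) / 2) ∈ Set.Ioo θ 1 :=
    ⟨lt_min (by linarith) (by linarith), (min_le_right _ _).trans_lt (by linarith)⟩
  have h2 : max (θ - δ) (θ / 2) ∈ Set.Ioo 0 θ :=
    ⟨(by linarith : 0 < θ / 2).trans_le (le_max_right _ _), max_lt (by linarith) (by linarith)⟩
  filter_upwards [hup _ h1, hlow _ h2, eventually_gt_atTop 0,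
    tendsto_log_natCast.eventually_gt_atTop 0,
    tendsto_log_natCast.eventually_ge_atTop (Real.log 3 / (δ / 2))] with d hu hl hd hL hL3
  set a := min (θ + δ / 2) ((θ + 1) / 2)
  set b := max (θ - δ) (θ / 2)
  have hd1 : (1 : ℝ) ≤ d := by exact_mod_cast hd
  have hd0 : (0 : ℝ) < d := by linarith
  have hN : (0 : ℝ) < N d := (Real.rpow_pos_of_pos hd0 b).trans_le hl
  have hu' : (N d : ℝ) ≤ 3 * (d : ℝ) ^ a := by
    have h3 : (N d : ℝ) ≤ 2 * ⌊(d : ℝ) ^ a⌋₊ + 1 := by exact_mod_cast hu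
    have h4 := Nat.floor_le (Real.rpow_pos_of_pos hd0 a).le
    have h5 := Real.one_le_rpow hd1 (hθ0.trans h1.1).le
    linarith
  have hlogu := Real.log_le_log hN hu'
  rw [Real.log_mul (by norm_num) (by positivity), Real.log_rpow hd0] at hlogu
  have hlogl := Real.log_le_log (by positivity) hl
  rw [Real.log_rpow hd0] at hlogl
  rw [Real.norm_of_nonneg hL.le, Real.norm_eq_abs, abs_le]
  rw [div_le_iff₀ (by positivity)] at hL3
  have ha : a * Real.log d ≤ (θ + δ / 2) * Real.log d :=
    mul_le_mul_of_nonneg_right (min_le_left _ _) hL.le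
  have hb : (θ - δ) * Real.log d ≤ b * Real.log d :=
    mul_le_mul_of_nonneg_right (le_max_left _ _) hL.le
  constructor <;> linarith

end Asymptotic

theorem mainTheorem5
    (α β σ : ℕ → ℝ) (c r : ℝ)
    (hα : ∀ j, 1 ≤ j → 0 < α j) (hβ : ∀ j, 1 ≤ j → 0 < β j) (hσ : ∀ j, 1 ≤ j → 1 < σ j)
    (hc : 0 < c) (hr : 0 ≤ r)
    (hβ_asymp : β ~[atTop] fun j : ℕ => c * (j : ℝ) ^ (-1 : ℝ))
    (hαβ : Tendsto (fun j => α j / β j) atTop (𝓝 r))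
    (hσ_top : Tendsto σ atTop atTop)
    (Ω : ℕ → Type*) [∀ d, MeasurableSpace (Ω d)]
    (P : ∀ d, Measure (Ω d)) [∀ d, IsProbabilityMeasure (P d)]
    (Y : ∀ d, Ω d → (Fin d → unitInterval) → ℝ)
    (hY : ∀ d, 1 ≤ d → IsCenteredField (P d) (Y d)
      (additiveKernel (fun j => korobovKernel (α j) (β j) (σ j)) d))
    (ε₀ : ℝ) (hε₀ : ε₀ = (1 + r / 2) ^ (-(1 / 2) : ℝ)) :
    (ε₀ ∈ Set.Ioc (0 : ℝ) 1 ∧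
      Tendsto (fun d : ℕ =>
          (∑ j ∈ Finset.Icc 1 d, oneEigenvalue (korobovKernel (α j) (β j) (σ j))) /
            ∑ j ∈ Finset.Icc 1 d, kernelTrace (korobovKernel (α j) (β j) (σ j)))
        atTop (𝓝 (1 - ε₀ ^ 2))) ∧
    ∀ ε ∈ Set.Ioo (0 : ℝ) ε₀,
      1 - (ε / ε₀) ^ 2 ∈ Set.Ioo (0 : ℝ) 1 ∧
      (fun d : ℕ => Real.log (approxComplexity (P d) (Y d) ε)
          - (1 - (ε / ε₀) ^ 2) * Real.log d) =o[atTop] fun d : ℕ => Real.log d := by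
  have hε₀pos : 0 < ε₀ := by rw [hε₀]; positivity
  have hε₀sq : ε₀ ^ 2 = (1 + r / 2)⁻¹ := by
    rw [hε₀, ← Real.rpow_natCast, ← Real.rpow_mul (by positivity), ← Real.rpow_neg_one]
    norm_num
  have hε₀le : ε₀ ≤ 1 := by
    rw [hε₀]
    exact Real.rpow_le_one_of_one_le_of_nonpos (by linarith) (by norm_num)
  have hβj : Tendsto (fun j : ℕ => β j * j) atTop (𝓝 c) := by
    have h1 : ∀ᶠ j : ℕ in atTop, c * (j : ℝ) ^ (-1 : ℝ) ≠ 0 := by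
      filter_upwards [eventually_gt_atTop 0] with j hj
      have : (0 : ℝ) < j := by exact_mod_cast hj
      positivity
    have h2 := ((isEquivalent_iff_tendsto_one h1).1 hβ_asymp).mul_const c
    rw [one_mul] at h2
    refine h2.congr' ?_
    filter_upwards [eventually_gt_atTop 0] with j hj
    have : (0 : ℝ) < j := by exact_mod_cast hj
    simp only [Pi.div_apply, Real.rpow_neg_one]
    field_simp
  have hαj : Tendsto (fun j : ℕ => α j * j) atTop (𝓝 (r * c)) := by
    refine (hαβ.mul hβj).congr' ?_
    filter_upwards [eventually_ge_atTop 1] with j hj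
    have := hβ j hj
    field_simp
  have hTj : Tendsto (fun j : ℕ => (α j + 2 * β j * zetaSum (σ j)) * j) atTop
      (𝓝 (r * c + 2 * c)) := by
    have h := hαj.add ((hβj.const_mul 2).mul (tendsto_zetaSum hσ_top))
    rw [mul_one] at h
    exact h.congr fun j => by ring
  have hA := tendsto_sum_div_log hαj
  have hS := tendsto_sum_div_log hβj
  have hT := tendsto_sum_div_log hTj
  refine ⟨⟨⟨hε₀pos, hε₀le⟩, ?_⟩, ?_⟩
  · have h := hA.div hT (by positivity)
    have hval : r * c / (r * c + 2 * c) = 1 - ε₀ ^ 2 := by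
      rw [hε₀sq]
      field_simp
      ring
    rw [hval] at h
    refine h.congr' ?_
    filter_upwards [tendsto_log_natCast.eventually_gt_atTop 0] with d hL
    simp only [Pi.div_apply, kernelTrace_korobovKernel]
    rw [div_div_div_cancel_right₀ hL.ne']
    congr 1
    exact Finset.sum_congr rfl fun j hj =>
      (oneEigenvalue_korobovKernel _ _ (hσ j (Finset.mem_Icc.1 hj).1)).symm
  rintro ε ⟨hε0, hεlt⟩
  have hθ : 1 - (ε / ε₀) ^ 2 ∈ Set.Ioo (0 : ℝ) 1 := by
    have h1 : ε / ε₀ < 1 := (div_lt_one hε₀pos).2 hεlt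
    have h2 : 0 < ε / ε₀ := by positivity
    constructor <;> nlinarith
  refine ⟨hθ, ?_⟩
  have hθval : (ε / ε₀) ^ 2 = ε ^ 2 * (1 + r / 2) := by
    rw [div_pow, hε₀sq, div_inv_eq_mul]
  set θ := 1 - (ε / ε₀) ^ 2 with hθdef
  have hupper : ∀ a ∈ Set.Ioo θ 1, ∀ᶠ d : ℕ in atTop,
      avgError (P d) (Y d) (2 * ⌊(d : ℝ) ^ a⌋₊ + 1)
        ≤ ENNReal.ofReal ε * avgError (P d) (Y d) 0 := by
    intro a ha
    have ha0 : 0 < a := hθ.1.trans ha.1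
    have h := ((hT.const_mul (1 - ε ^ 2)).sub hA).sub
      ((tendsto_sum_floor_rpow_div_log ha0 hβj).const_mul 2)
    have hneg : (1 - ε ^ 2) * (r * c + 2 * c) - r * c - 2 * (c * a) < 0 := by
      have h1 : (1 - ε ^ 2) * (r * c + 2 * c) - r * c - 2 * (c * a) = 2 * (c * (θ - a)) := by
        rw [hθdef, hθval]
        ring
      have := mul_neg_of_pos_of_neg hc (sub_neg.2 ha.1)
      linarith
    filter_upwards [h.eventually_lt_const hneg, tendsto_log_natCast.eventually_gt_atTop 0,
      eventually_ge_atTop 1] with d hd hL hd1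
    have hd1' : (1 : ℝ) ≤ d := by exact_mod_cast hd1
    have hmd : ⌊(d : ℝ) ^ a⌋₊ ≤ d := Nat.floor_le_of_le (by
      simpa using Real.rpow_le_rpow_of_exponent_le hd1' ha.2.le)
    refine avgError_two_mul_add_one_le hα hβ hσ (hY d hd1) hε0.le hmd ?_
    rw [← mul_div_assoc, ← mul_div_assoc, ← sub_div, ← sub_div, div_lt_iff₀ hL, zero_mul] at hd
    linarith
  refine isLittleO_log_of_rpow_bounds hθ (fun a ha => ?_) fun a ha => ?_
  · filter_upwards [hupper a ha] with d hd
    exact Nat.sInf_le ⟨by omega, hd⟩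
  · obtain ⟨C, hC⟩ := hβj.bddAbove_range
    have hC' (j : ℕ) : β j * j ≤ C := hC ⟨j, rfl⟩
    have hC0 : 0 < C := by
      have := hC' 1
      have := hβ 1 le_rfl
      push_cast at *
      linarith
    have hδ : 0 < c * (θ - a) := mul_pos hc (sub_pos.2 ha.2)
    have h := ((hS.sub (tendsto_sum_floor_rpow_div_log ha.1 hβj)).const_mul 2).sub
      (hT.const_mul (ε ^ 2))
    have hlim : c * (θ - a) < 2 * (c - c * a) - ε ^ 2 * (r * c + 2 * c) := by
      have h1 : 2 * (c - c * a) - ε ^ 2 * (r * c + 2 * c) = 2 * (c * (θ - a)) := by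
        rw [hθdef, hθval]
        ring
      linarith
    filter_upwards [h.eventually_const_lt hlim, hupper ((θ + 1) / 2)
      ⟨by linarith [hθ.2], by linarith [hθ.2]⟩, tendsto_log_natCast.eventually_gt_atTop 0,
      tendsto_log_natCast.eventually_ge_atTop (2 * C / (c * (θ - a))),
      eventually_half_rpow_le_floor ha.1, eventually_ge_atTop 1] with d hd hne hL hL2 hfl hd1
    have hd1' : (1 : ℝ) ≤ d := by exact_mod_cast hd1
    set m := ⌊(d : ℝ) ^ a⌋₊ with hm
    have hmd : m ≤ d := Nat.floor_le_of_le (by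
      simpa using Real.rpow_le_rpow_of_exponent_le hd1' (ha.2.trans hθ.2).le)
    have hm0 : (0 : ℝ) < m := by exact_mod_cast hfl.2
    have hmem : approxComplexity (P d) (Y d) ε ∈ {n : ℕ | 1 ≤ n ∧
        avgError (P d) (Y d) n ≤ ENNReal.ofReal ε * avgError (P d) (Y d) 0} :=
      Nat.sInf_mem ⟨_, by omega, hne⟩
    have hkey := sum_sub_le_of_avgError_le hα hβ hσ (hY d hd1) hε0.le
      (M := C / m) (by positivity) hmd (fun j hj => by
        have hmj : (m : ℝ) ≤ j := by exact_mod_cast hj.le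
        rw [le_div_iff₀ hm0]
        exact (mul_le_mul_of_nonneg_left hmj (hβ j (by omega)).le).trans (hC' j)) hmem.2
    rw [← sub_div, ← mul_div_assoc, ← mul_div_assoc, ← sub_div, lt_div_iff₀ hL] at hd
    rw [div_le_iff₀ hδ, mul_comm] at hL2
    have h3 : 2 * C ≤ C / m * (approxComplexity (P d) (Y d) ε : ℝ) := by linarith
    rw [div_mul_eq_mul_div, le_div_iff₀ hm0] at h3
    have h4 : 2 * (m : ℝ) ≤ approxComplexity (P d) (Y d) ε := by
      refine le_of_mul_le_mul_left ?_ hC0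
      linarith
    linarith [hfl.1]
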